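/- Let $K$ agents be connected by a network with combination matrix $A=[a_{\ell k}]$, $a_{\ell k}\ge 0$, $\sum_{\ell}a_{\ell k}=1$ for each $k$, which is strongly connected (any two distinct agents are joined in both directions by paths with positive weights, and $a_{mm}>0$ for some $m$), and let $\pi$ be its Perron vector: $A\pi=\pi$, $\sum_k\pi_k=1$, $\pi_k>0$. Agent $k$ has a feature space $\mathcal H_k$, a probability distribution $L_k(\cdot\mid\gamma)$ on $\mathcal H_k$ for each label $\gamma\in\{+1,-1\}$, a (suitably measurable) class $\mathcal F_k$ of functions $\mathcal H_k\to\mathbb R$, and $N_k\ge 1$ i.i.d. training pairs $(\tilde h_{k,n},\tilde\gamma_{k,n})$ with law $\tilde p_k(h,\gamma)=\tfrac12L_k(h\mid\gamma)$. Assume that $|f_k(h)|\le\beta$ for all $k$, $f_k\in\mathcal F_k$, $h\in\mathcal H_k$, where $\beta>0$. Let $\phi:\mathbb R\to[0,\infty)$ be convex, non-increasing, differentiable at $0$ with $\phi'(0)<0$, and $L_\phi$-Lipschitz (it suffices that it is so on $[-\beta,\beta]$). Let $\tilde f_k\in\mathcal F_k$ be a minimizer over $\mathcal F_k$ of the empirical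 risk $\frac1{N_k}\sum_{n=1}^{N_k}\phi(\tilde\gamma_{k,n}f_k(\tilde h_{k,n}))$. Put $$\mu^{\pm}(f)=\sum_k\pi_k\,\mathbb E_{h\sim L_k(\cdot\mid\pm1)}f_k(h),\qquad \tilde\mu(f)=\sum_k\pi_k\frac1{N_k}\sum_{n=1}^{N_k}f_k(\tilde h_{k,n}),$$ $$P_c=\mathbb P\big(\mu^+(\tilde f)>\tilde\mu(\tilde f)\ \text{and}\ \mu^-(\tilde f)<\tilde\mu(\tilde f)\big),\qquad \mathsf R^o=\sum_k\pi_k\inf_{f_k\in\mathcal F_k}\mathbb E_{(h,\gamma)\sim\tilde p_k}\,\phi(\gamma f_k(h)),$$ $$\rho=\sum_k\pi_k\,\mathbb E\sup_{f_k\in\mathcal F_k}\Big|\frac1{N_k}\sum_{n=1}^{N_k}r_nf_k(\tilde h_{k,n})\Big|,\qquad N_{\max}=\max_kN_k,\qquad \alpha=\sum_k\pi_k\frac{N_{\max}}{N_k},$$ where the $r_n$ are i.i.d. uniform signs, independent of the $\tilde h_{k,n}$. Assume $\mathsf R^o<\phi(0)$. Then the equation $$d-\frac{\phi(d)-\mathsf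 R^o}{2L_\phi}=0$$ has exactly one solution $d_0^\star\in\mathbb R$, and $d_0^\star>0$. Moreover, with $\mathcal E(\mathsf R^o,0)=d_0^\star/4$, if $\rho<\mathcal E(\mathsf R^o,0)$, then $$P_c\ \ge\ 1-2\exp\Big\{-\frac{8N_{\max}}{\alpha^2\beta^2}\big(\mathcal E(\mathsf R^o,0)-\rho\big)^2\Big\}.$$ -/

import Mathlib

open MeasureTheory ProbabilityTheory
open scoped NNReal ENNReal

namespace SocialLearning

/-! ### The network of agents -/

/-- `A ℓ k` is the weight that agent `k` assigns to agent `ℓ`. The weights are nonnegative and those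
assigned by each agent sum to one; the neighbours of `k` are the `ℓ` with `0 < A ℓ k`. -/
structure IsCombinationMatrix {K : ℕ} (A : Matrix (Fin K) (Fin K) ℝ) : Prop where
  nonneg : ∀ l k, 0 ≤ A l k
  sum_col : ∀ k, ∑ l, A l k = 1

/-- Any two distinct agents are joined in both directions by paths with positive weights, and some
agent has a self-loop. -/
structure IsStronglyConnected {K : ℕ} (A : Matrix (Fin K) (Fin K) ℝ) : Prop where
  path : ∀ l k, l ≠ k → Relation.TransGen (fun i j => 0 < A i j) l k
  self_loop : ∃ m, 0 < A m m

/-- The normalized, entrywise positive Perron eigenvector of `A`. -/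
structure IsPerronVector {K : ℕ} (A : Matrix (Fin K) (Fin K) ℝ) (w : Fin K → ℝ) : Prop where
  mulVec_eq : A.mulVec w = w
  sum_eq_one : ∑ k, w k = 1
  pos : ∀ k, 0 < w k

/-! ### Loss functions and function classes -/

/-- The conditions on the loss function, for classifiers with values in `[-β, β]`: the Lipschitz
condition with constant `Lip` is only required there, where the loss is evaluated. -/
structure IsLoss (φ : ℝ → ℝ) (Lip : ℝ≥0) (β : ℝ) : Prop where
  nonneg : ∀ x, 0 ≤ φ x
  convex : ConvexOn ℝ Set.univ φ
  antitone : Antitone φ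
  differentiableAt_zero : DifferentiableAt ℝ φ 0
  deriv_zero_neg : deriv φ 0 < 0
  lipschitz : LipschitzOnWith Lip φ (Set.Icc (-β) β)

/-- Measurability of a class of real functions: its members are measurable, and so is, for each open
`U ⊆ ℝᵐ`, the set of the `x ∈ Xᵐ` such that `(f x₁, …, f xₘ) ∈ U` for some `f` in the class.
Thus suprema over the class of continuous functions of finitely many values of `f` are measurable.
(The second part is automatic if a countable subclass is dense for pointwise convergence.) -/
structure IsMeasurableClass {X : Type*} [MeasurableSpace X] (F : Set (X → ℝ)) : Prop where
  measurable : ∀ f ∈ F, Measurable f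
  measurableSet_exists : ∀ (m : ℕ) (U : Set (Fin m → ℝ)), IsOpen U →
    MeasurableSet {x : Fin m → X | ∃ f ∈ F, (fun i => f (x i)) ∈ U}

/-! ### One agent: `ℤˣ = {1, -1}` is the set of labels -/

section Agent

variable {X : Type*} [MeasurableSpace X]

/-- The value in `ℝ` of a label or of a Rademacher sign. -/
def sgn (γ : ℤˣ) : ℝ := ((γ : ℤ) : ℝ)

/-- The law of a training pair: `L(h | γ) p(γ)` with `p(+1) = p(-1) = 1 / 2`. -/
noncomputable def trainingLaw (L : ℤˣ → Measure X) : Measure (X × ℤˣ) :=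
  ∑ γ : ℤˣ, (1 / 2 : ℝ≥0∞) • (L γ).map (fun h => (h, γ))

/-- Conditional mean of `f` under the label `γ`. -/
noncomputable def condMean (L : ℤˣ → Measure X) (γ : ℤˣ) (f : X → ℝ) : ℝ :=
  ∫ h, f h ∂(L γ)

/-- Expected risk of `f`. -/
noncomputable def risk (φ : ℝ → ℝ) (L : ℤˣ → Measure X) (f : X → ℝ) : ℝ :=
  ∫ z, φ (sgn z.2 * f z.1) ∂(trainingLaw L)

/-- Target risk of the class `F`. -/
noncomputable def targetRisk (φ : ℝ → ℝ) (L : ℤˣ → Measure X) (F : Set (X → ℝ)) : ℝ :=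
  ⨅ f : F, risk φ L f

/-- Empirical risk of `f` on the training set `z`. -/
noncomputable def empRisk (φ : ℝ → ℝ) {n : ℕ} (z : Fin n → X × ℤˣ) (f : X → ℝ) : ℝ :=
  (1 / (n : ℝ)) * ∑ i, φ (sgn (z i).2 * f (z i).1)

/-- Empirical training mean of `f` on the training set `z`. -/
noncomputable def empMean {n : ℕ} (z : Fin n → X × ℤˣ) (f : X → ℝ) : ℝ :=
  (1 / (n : ℝ)) * ∑ i, f (z i).1

/-- Empirical Rademacher complexity of `F` on the sample set `h`: the average over all sign vectors
`r` of the largest absolute correlation of `F` with `r`. -/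
noncomputable def empRademacher (F : Set (X → ℝ)) {n : ℕ} (h : Fin n → X) : ℝ :=
  (1 / (2 : ℝ) ^ n) * ∑ r : Fin n → ℤˣ, ⨆ f : F, |(1 / (n : ℝ)) * ∑ i, sgn (r i) * f.1 (h i)|

/-- Expected Rademacher complexity of `F` for `n` independent training samples. -/
noncomputable def rademacher (L : ℤˣ → Measure X) (F : Set (X → ℝ)) (n : ℕ) : ℝ :=
  ∫ h : Fin n → X, empRademacher F h ∂(Measure.pi fun _ => (trainingLaw L).fst)

/-- `Z 0, …, Z (n - 1)` are independent training pairs with the law of the model `L`. -/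
structure IsTrainingSet {Ω : Type*} [MeasurableSpace Ω] (P : Measure Ω) (L : ℤˣ → Measure X)
    {n : ℕ} (Z : Fin n → Ω → X × ℤˣ) : Prop where
  measurable : ∀ i, Measurable (Z i)
  map_eq : ∀ i, P.map (Z i) = trainingLaw L
  indep : iIndepFun Z P

/-- `f` minimizes the empirical risk over the class `F` on the training set `z`. -/
structure IsTrained (φ : ℝ → ℝ) (F : Set (X → ℝ)) {n : ℕ} (z : Fin n → X × ℤˣ) (f : X → ℝ) :
    Prop where
  mem : f ∈ F
  le : ∀ g ∈ F, empRisk φ z f ≤ empRisk φ z g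

end Agent

/-! ### Network quantities -/

section Network

variable {K : ℕ} {H : Fin K → Type*} [∀ k, MeasurableSpace (H k)]

/-- Network average of the conditional means under the label `γ`. -/
noncomputable def netCondMean (w : Fin K → ℝ) (L : ∀ k, ℤˣ → Measure (H k)) (γ : ℤˣ)
    (f : ∀ k, H k → ℝ) : ℝ :=
  ∑ k, w k * condMean (L k) γ (f k)

/-- Network average of the empirical training means. -/
noncomputable def netEmpMean (w : Fin K → ℝ) {N : Fin K → ℕ} (z : ∀ k, Fin (N k) → H k × ℤˣ)
    (f : ∀ k, H k → ℝ) : ℝ :=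
  ∑ k, w k * empMean (z k) (f k)

/-- Network average of the target risks. -/
noncomputable def netTargetRisk (w : Fin K → ℝ) (φ : ℝ → ℝ) (L : ∀ k, ℤˣ → Measure (H k))
    (F : ∀ k, Set (H k → ℝ)) : ℝ :=
  ∑ k, w k * targetRisk φ (L k) (F k)

/-- Expected network Rademacher complexity. -/
noncomputable def netRademacher (w : Fin K → ℝ) (L : ∀ k, ℤˣ → Measure (H k))
    (F : ∀ k, Set (H k → ℝ)) (N : Fin K → ℕ) : ℝ :=
  ∑ k, w k * rademacher (L k) (F k) (N k)

/-- The largest number of training samples of an agent. -/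
def maxSamples (N : Fin K → ℕ) : ℕ := Finset.univ.sup N

/-- Network imbalance penalty. -/
noncomputable def imbalance (w : Fin K → ℝ) (N : Fin K → ℕ) : ℝ :=
  ∑ k, w k * ((maxSamples N : ℝ) / (N k : ℝ))

/-- The probability of consistent training of the trained functions `f`. -/
noncomputable def probConsistent {Ω : Type*} [MeasurableSpace Ω] (P : Measure Ω) (w : Fin K → ℝ)
    (L : ∀ k, ℤˣ → Measure (H k)) {N : Fin K → ℕ} (Z : ∀ k, Fin (N k) → Ω → H k × ℤˣ)
    (f : Ω → ∀ k, H k → ℝ) : ℝ :=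
  P.real {ω | netCondMean w L 1 (f ω) > netEmpMean w (fun k n => Z k n ω) (f ω) ∧
    netCondMean w L (-1) (f ω) < netEmpMean w (fun k n => Z k n ω) (f ω)}

end Network

/-- The function whose zero is the critical value `d₀⋆`. -/
noncomputable def criticalFun (φ : ℝ → ℝ) (Lip : ℝ≥0) (R d : ℝ) : ℝ :=
  d - (φ d - R) / (2 * (Lip : ℝ))

end SocialLearning

open SocialLearning

namespace SocialLearning

/-! ### The contraction principle -/

/-! Training is consistent as soon as the midpoint (μ⁺ + μ⁻)/2 is within d of the empirical mean and
the half-gap (μ⁺ - μ⁻)/2 exceeds d. The midpoint is the expected feature mean, because labels are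
balanced. For the half-gap, Jensen's inequality gives φ((μ⁺ - μ⁻)/2) ≤ network risk of the trained
functions, and empirical risk minimization bounds that risk by Rᵒ plus twice the uniform risk
deviation. If the deviation is below Lip · d, the risk is below Rᵒ + 2 Lip d, which equals φ(d)
exactly when d is the critical value; monotonicity of φ then gives the gap.

Both conditions thus ask that a uniform deviation, for a C-Lipschitz family (C = 1 for means, C =
Lip for risks), stay below C d. This deviation is dominated by `ghostDev`. Its mean is at most 4Cρ:
2 from symmetrization (`integral_ghostDev_le_integral_supSigned`) and 2C from contraction
(`sum_ciSup_abs_contraction`). Its fluctuations are sub-Gaussian by McDiarmid's inequality. The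
resulting tail bound `measureReal_le_sum_ghostDev_le` does not depend on C, so the two failures cost
the same, hence the factor 2. -/

theorem sum_intUnits {M : Type*} [AddCommMonoid M] (g : ℤˣ → M) :
    ∑ ε : ℤˣ, g ε = g 1 + g (-1) := by
  rw [show (Finset.univ : Finset ℤˣ) = {1, -1} from rfl, Finset.sum_pair (by decide)]

theorem sgn_one : sgn 1 = 1 := by simp [sgn]

theorem sgn_neg_one : sgn (-1) = -1 := by simp [sgn]

theorem sgn_neg (ε : ℤˣ) : sgn (-ε) = -sgn ε := by simp [sgn]

theorem abs_sgn (ε : ℤˣ) : |sgn ε| = 1 := by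
  rcases Int.units_eq_one_or ε with rfl | rfl <;> simp [sgn]

theorem bddAbove_range_of_abs_le {ι : Type*} {u : ι → ℝ} {B : ℝ} (h : ∀ t, |u t| ≤ B) :
    BddAbove (Set.range u) :=
  ⟨B, by rintro _ ⟨t, rfl⟩; exact (abs_le.1 (h t)).2⟩

theorem abs_sum_sgn_mul_le {n : ℕ} (r : Fin n → ℤˣ) (b : Fin n → ℝ) :
    |∑ i, sgn (r i) * b i| ≤ ∑ i, |b i| := by
  refine (Finset.abs_sum_le_sum_abs _ _).trans_eq ?_
  simp [abs_mul, abs_sgn]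

/-- For a pair (t, s), the left side contributes v t + v s + (b t - b s) ≤ v t + v s + |a t - a s|.
The sign of a t - a s decides whether (t, s) or (s, t) attains this value on the right. -/
theorem ciSup_add_add_ciSup_sub_le {ι : Type*} [Nonempty ι] {v a b : ι → ℝ} {B C : ℝ}
    (hv : ∀ t, |v t| ≤ B) (ha : ∀ t, |a t| ≤ C) (hab : ∀ t s, |b t - b s| ≤ |a t - a s|) :
    (⨆ t, (v t + b t)) + ⨆ t, (v t - b t) ≤ (⨆ t, (v t + a t)) + ⨆ t, (v t - a t) := by
  have h1 : BddAbove (Set.range fun t => v t + a t) :=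
    bddAbove_range_of_abs_le fun t => (abs_add_le _ _).trans (add_le_add (hv t) (ha t))
  have h2 : BddAbove (Set.range fun t => v t - a t) :=
    bddAbove_range_of_abs_le fun t => (abs_sub _ _).trans (add_le_add (hv t) (ha t))
  rw [← le_sub_iff_add_le]
  refine ciSup_le fun t => ?_
  rw [le_sub_iff_add_le, ← le_sub_iff_add_le']
  refine ciSup_le fun s => ?_
  have hb := (le_abs_self _).trans (hab t s)
  have e1 := le_ciSup h1 t
  have e2 := le_ciSup h2 s
  have e3 := le_ciSup h1 s
  have e4 := le_ciSup h2 t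
  rcases abs_cases (a t - a s) with ⟨h, -⟩ | ⟨h, -⟩ <;> rw [h] at hb <;> linarith

/-- The offset `u` is there for the induction: it absorbs the signed term of coordinate 0 while the
other coordinates are replaced, and then coordinate 0 is treated with the two-sign inequality. -/
theorem sum_ciSup_contraction {ι : Type*} [Nonempty ι] {n : ℕ} {B C : ℝ} :
    ∀ {u : ι → ℝ} {a b : Fin n → ι → ℝ}, (∀ t, |u t| ≤ B) → (∀ i t, |a i t| ≤ C) →
      (∀ i t, |b i t| ≤ C) → (∀ i t s, |b i t - b i s| ≤ |a i t - a i s|) →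
      ∑ r : Fin n → ℤˣ, ⨆ t, (u t + ∑ i, sgn (r i) * b i t) ≤
        ∑ r : Fin n → ℤˣ, ⨆ t, (u t + ∑ i, sgn (r i) * a i t) := by
  induction n generalizing B with
  | zero => intro u a b _ _ _ _; simp
  | succ n ih =>
    intro u a b hu ha hb hab
    have key (c : Fin (n + 1) → ι → ℝ) :
        ∑ r : Fin (n + 1) → ℤˣ, ⨆ t, (u t + ∑ i, sgn (r i) * c i t) =
          ∑ ε : ℤˣ, ∑ r : Fin n → ℤˣ,
            ⨆ t, ((u t + sgn ε * c 0 t) + ∑ i, sgn (r i) * c i.succ t) := by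
      rw [← Fintype.sum_prod_type', ← (Fin.consEquiv fun _ => ℤˣ).sum_comp]
      simp [Fin.consEquiv, Fin.sum_univ_succ, add_assoc]
    rw [key, key]
    have hstep (ε : ℤˣ) := ih (u := fun t => u t + sgn ε * b 0 t) (a := fun i => a i.succ)
      (b := fun i => b i.succ) (B := B + C)
      (fun t => (abs_add_le _ _).trans (add_le_add (hu t)
        (by rw [abs_mul, abs_sgn, one_mul]; exact hb 0 t)))
      (fun i => ha i.succ) (fun i => hb i.succ) (fun i => hab i.succ)
    refine (Finset.sum_le_sum fun ε _ => hstep ε).trans ?_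
    rw [Finset.sum_comm, Finset.sum_comm (s := Finset.univ (α := ℤˣ))]
    refine Finset.sum_le_sum fun r _ => ?_
    have h := ciSup_add_add_ciSup_sub_le (v := fun t => u t + ∑ i, sgn (r i) * a i.succ t)
      (a := a 0) (b := b 0) (B := B + ∑ i : Fin n, C) (C := C)
      (fun t => (abs_add_le _ _).trans (add_le_add (hu t)
        ((abs_sum_sgn_mul_le _ _).trans (Finset.sum_le_sum fun i _ => ha i.succ t))))
      (ha 0) (hab 0)
    simp only [sum_intUnits, sgn_one, sgn_neg_one, one_mul, neg_one_mul, ← sub_eq_add_neg]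
    simpa only [add_right_comm, add_sub_right_comm] using h

/-- The contraction principle for Rademacher averages of absolute values. -/
theorem sum_ciSup_abs_contraction {ι : Type*} [Nonempty ι] {n : ℕ} {a b : Fin n → ι → ℝ} {C : ℝ}
    (ha : ∀ i t, |a i t| ≤ C) (hba : ∀ i t, |b i t| ≤ |a i t|)
    (hab : ∀ i t s, |b i t - b i s| ≤ |a i t - a i s|) :
    ∑ r : Fin n → ℤˣ, ⨆ t, |∑ i, sgn (r i) * b i t| ≤
      2 * ∑ r : Fin n → ℤˣ, ⨆ t, |∑ i, sgn (r i) * a i t| := by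
  obtain ⟨t₀⟩ := ‹Nonempty ι›
  have hne : Nonempty ι := ⟨t₀⟩
  have hC (i : Fin n) : 0 ≤ C := (abs_nonneg _).trans (ha i t₀)
  have hb i t : |b i t| ≤ C := (hba i t).trans (ha i t)
  -- The extra index `none` carries the zero vector, so all suprema are nonnegative and sup |x| ≤
  -- sup x + sup (-x). Both terms have the same sum over r, whence the factor 2. Comparison with
  -- `none` is the hypothesis |b| ≤ |a|.
  let a' : Fin n → Option ι → ℝ := fun i t => t.elim 0 (a i)
  let b' : Fin n → Option ι → ℝ := fun i t => t.elim 0 (b i)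
  have ha' i t : |a' i t| ≤ C := by
    cases t with
    | none => simpa [a'] using hC i
    | some t => exact ha i t
  have hb' i t : |b' i t| ≤ C := by
    cases t with
    | none => simpa [b'] using hC i
    | some t => exact hb i t
  have hab' i t s : |b' i t - b' i s| ≤ |a' i t - a' i s| := by
    cases t <;> cases s <;> simp [a', b', hba, hab]
  have hbdd {κ : Type _} (c : Fin n → κ → ℝ) (hc : ∀ i t, |c i t| ≤ C) (r : Fin n → ℤˣ) (t : κ) :
      |∑ i, sgn (r i) * c i t| ≤ ∑ i : Fin n, C :=
    (abs_sum_sgn_mul_le _ _).trans (Finset.sum_le_sum fun i _ => hc i t)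
  have hone (r : Fin n → ℤˣ) : ⨆ t, |∑ i, sgn (r i) * b i t| ≤
      (⨆ t, ∑ i, sgn (r i) * b' i t) + ⨆ t, ∑ i, sgn ((-r) i) * b' i t := by
    refine ciSup_le fun t => ?_
    have e1 := le_ciSup (bddAbove_range_of_abs_le (hbdd b' hb' r)) none
    have e2 := le_ciSup (bddAbove_range_of_abs_le (hbdd b' hb' (-r))) none
    have e3 := le_ciSup (bddAbove_range_of_abs_le (hbdd b' hb' r)) (some t)
    have e4 := le_ciSup (bddAbove_range_of_abs_le (hbdd b' hb' (-r))) (some t)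
    simp only [b', Option.elim_none, Option.elim_some, mul_zero, Finset.sum_const_zero,
      Pi.neg_apply, sgn_neg, neg_mul, Finset.sum_neg_distrib] at e1 e2 e3 e4 ⊢
    rcases abs_cases (∑ i, sgn (r i) * b i t) with ⟨h, -⟩ | ⟨h, -⟩ <;> rw [h] <;> linarith
  have hneg : ∑ r : Fin n → ℤˣ, ⨆ t, ∑ i, sgn ((-r) i) * b' i t =
      ∑ r : Fin n → ℤˣ, ⨆ t, ∑ i, sgn (r i) * b' i t :=
    Equiv.sum_comp (Equiv.neg (Fin n → ℤˣ)) fun r => ⨆ t, ∑ i, sgn (r i) * b' i t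
  have hcontr := sum_ciSup_contraction (u := fun _ : Option ι => (0 : ℝ)) (B := 0)
    (by simp) ha' hb' hab'
  simp only [zero_add] at hcontr
  refine (Finset.sum_le_sum fun r _ => hone r).trans ?_
  rw [Finset.sum_add_distrib, hneg, ← two_mul]
  refine mul_le_mul_of_nonneg_left (hcontr.trans (Finset.sum_le_sum fun r _ => ?_)) zero_le_two
  have hbd : BddAbove (Set.range fun t => |∑ i, sgn (r i) * a i t|) :=
    bddAbove_range_of_abs_le fun t => by rw [abs_abs]; exact hbdd a ha r t
  refine ciSup_le fun t => ?_
  cases t with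
  | none => simpa [a'] using Real.iSup_nonneg fun t => abs_nonneg (∑ i, sgn (r i) * a i t)
  | some t => exact (le_abs_self _).trans (le_ciSup hbd t)

/-! ### The bounded difference inequality -/

theorem integrable_of_abs_le {Y : Type*} [MeasurableSpace Y] {q : Measure Y} [IsFiniteMeasure q]
    {g : Y → ℝ} {B : ℝ} (hg : Measurable g) (hB : ∀ y, |g y| ≤ B) : Integrable g q :=
  .of_bound hg.aestronglyMeasurable B (.of_forall hB)

/-- Hoeffding's lemma: the values of `g` lie in an interval of length `c` starting at its infimum.
-/
theorem integral_exp_le_of_abs_sub_le {Y : Type*} [MeasurableSpace Y] {q : Measure Y}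
    [IsProbabilityMeasure q] {g : Y → ℝ} (hg : Measurable g) {c : ℝ}
    (hc : ∀ y y', |g y - g y'| ≤ c) :
    ∫ y, Real.exp (g y) ∂q ≤ Real.exp (c ^ 2 / 8 + ∫ y, g y ∂q) := by
  have : Nonempty Y := nonempty_of_isProbabilityMeasure q
  obtain ⟨y₀⟩ := this
  have hbdd : BddBelow (Set.range g) :=
    ⟨g y₀ - c, by rintro _ ⟨y, rfl⟩; linarith [(abs_le.1 (hc y₀ y)).2]⟩
  have hI : ∀ y, g y ∈ Set.Icc (⨅ y, g y) ((⨅ y, g y) + c) := fun y => by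
    refine ⟨ciInf_le hbdd y, ?_⟩
    rw [← sub_le_iff_le_add]
    have : Nonempty Y := ⟨y₀⟩
    exact le_ciInf fun y' => by linarith [(abs_le.1 (hc y y')).2]
  have h := (hasSubgaussianMGF_of_mem_Icc hg.aemeasurable (.of_forall hI) (μ := q)).mgf_le 1
  simp only [mgf, one_mul, Real.exp_sub, integral_div, add_sub_cancel_left] at h
  rw [div_le_iff₀ (Real.exp_pos _), ← Real.exp_add] at h
  refine h.trans_eq ?_
  congr 2
  push_cast
  rw [div_pow, Real.norm_eq_abs, sq_abs]
  ring

/-- McDiarmid's inequality in the form of a bound on the moment generating function. -/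
theorem integral_exp_le_of_bounded_differences {Y : Type*} [MeasurableSpace Y] (q : Measure Y)
    [IsProbabilityMeasure q] {c B : ℝ} {n : ℕ} :
    ∀ {g : (Fin n → Y) → ℝ}, Measurable g → (∀ z, |g z| ≤ B) →
      (∀ z i y, |g z - g (Function.update z i y)| ≤ c) →
      ∫ z, Real.exp (g z) ∂(Measure.pi fun _ => q) ≤
        Real.exp (n * c ^ 2 / 8 + ∫ z, g z ∂(Measure.pi fun _ => q)) := by
  induction n with
  | zero =>
    intro g _ _ _
    obtain ⟨a, rfl⟩ : ∃ a, g = fun _ => a :=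
      ⟨g isEmptyElim, funext fun z => congrArg g (Subsingleton.elim _ _)⟩
    simp
  | succ n ih =>
    intro g hg hB hc
    have hmp := (measurePreserving_piFinSuccAbove (fun _ : Fin (n + 1) => q) 0).symm
    have hcons : Measurable fun p : Y × (Fin n → Y) => (Fin.cons p.1 p.2 : Fin (n + 1) → Y) := by
      refine measurable_pi_iff.2 fun i => ?_
      cases i using Fin.cases with
      | zero => simpa using measurable_fst
      | succ i => exact (measurable_pi_apply i).comp measurable_snd
    have hint (h : (Fin (n + 1) → Y) → ℝ) (hh : Measurable h) {D : ℝ} (hD : ∀ z, |h z| ≤ D) :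
        ∫ z, h z ∂(Measure.pi fun _ => q) =
          ∫ x, ∫ y, h (Fin.cons y x) ∂q ∂(Measure.pi fun _ => q) := by
      rw [← hmp.integral_comp' h]
      have e (p : Y × (Fin n → Y)) :
          (MeasurableEquiv.piFinSuccAbove (fun _ : Fin (n + 1) => Y) 0).symm p =
            Fin.cons p.1 p.2 := by
        simp [MeasurableEquiv.piFinSuccAbove, Fin.insertNthEquiv]
      simp only [e]
      exact integral_prod_symm (fun p : Y × (Fin n → Y) => h (Fin.cons p.1 p.2))
        (integrable_of_abs_le (hh.comp hcons) fun p => hD _)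
    have hexp : Measurable fun z => Real.exp (g z) := Real.measurable_exp.comp hg
    have hexpB z : |Real.exp (g z)| ≤ Real.exp B := by
      rw [Real.abs_exp]; exact Real.exp_le_exp.2 (abs_le.1 (hB z)).2
    have hsec (x : Fin n → Y) : Measurable fun y => g (Fin.cons y x) :=
      hg.comp (hcons.comp (measurable_id.prodMk measurable_const))
    -- Integrating out coordinate 0 keeps the bounded differences in the other coordinates, so the
    -- induction hypothesis applies to this function; Hoeffding's lemma handles coordinate 0 for
    -- each fixed tail.
    have hG : Measurable fun x : Fin n → Y => ∫ y, g (Fin.cons y x) ∂q :=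
      ((hg.comp hcons).comp measurable_swap).stronglyMeasurable.integral_prod_right'.measurable
    have hGB (x : Fin n → Y) : |∫ y, g (Fin.cons y x) ∂q| ≤ B := by
      have := norm_integral_le_of_norm_le_const (μ := q) (f := fun y => g (Fin.cons y x))
        (.of_forall fun y => hB (Fin.cons y x))
      simpa using this
    have hE : Measurable fun x : Fin n → Y => ∫ y, Real.exp (g (Fin.cons y x)) ∂q :=
      ((hexp.comp hcons).comp measurable_swap).stronglyMeasurable.integral_prod_right'.measurable
    rw [hint _ hexp hexpB, hint _ hg hB]
    have h1 (x : Fin n → Y) : ∫ y, Real.exp (g (Fin.cons y x)) ∂q ≤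
        Real.exp (c ^ 2 / 8 + ∫ y, g (Fin.cons y x) ∂q) := by
      refine integral_exp_le_of_abs_sub_le (hsec x) fun y y' => ?_
      have := hc (Fin.cons y x) 0 y'
      rwa [Fin.update_cons_zero] at this
    have h2 := ih hG hGB fun x i y' => by
      rw [← integral_sub (integrable_of_abs_le (hsec _) fun y => hB _)
        (integrable_of_abs_le (hsec _) fun y => hB _)]
      have := norm_integral_le_of_norm_le_const (μ := q)
        (f := fun y => g (Fin.cons y x) - g (Fin.cons y (Function.update x i y'))) (C := c)
        (.of_forall fun y => by
          have := hc (Fin.cons y x) i.succ y'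
          rwa [← Fin.cons_update] at this)
      simpa using this
    calc ∫ x, ∫ y, Real.exp (g (Fin.cons y x)) ∂q ∂(Measure.pi fun _ => q)
        ≤ ∫ x, Real.exp (c ^ 2 / 8) * Real.exp (∫ y, g (Fin.cons y x) ∂q)
            ∂(Measure.pi fun _ => q) := by
          refine integral_mono (integrable_of_abs_le hE (B := Real.exp (c ^ 2 / 8 + B)) fun x => ?_)
            (integrable_of_abs_le (B := Real.exp (c ^ 2 / 8 + B))
              (measurable_const.mul (Real.measurable_exp.comp hG)) fun x => ?_)
            fun x => ?_
          · rw [abs_of_nonneg (integral_nonneg fun y => (Real.exp_pos _).le)]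
            exact (h1 x).trans (Real.exp_le_exp.2 (by linarith [(abs_le.1 (hGB x)).2]))
          · rw [← Real.exp_add, Real.abs_exp]
            exact Real.exp_le_exp.2 (by linarith [(abs_le.1 (hGB x)).2])
          · simpa only [Real.exp_add] using h1 x
      _ ≤ Real.exp (c ^ 2 / 8) * Real.exp (n * c ^ 2 / 8 +
            ∫ x, ∫ y, g (Fin.cons y x) ∂q ∂(Measure.pi fun _ => q)) := by
          rw [integral_const_mul]
          exact mul_le_mul_of_nonneg_left h2 (Real.exp_pos _).le
      _ = _ := by
          rw [← Real.exp_add]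
          congr 1
          push_cast
          ring

theorem hasSubgaussianMGF_of_bounded_differences {Y : Type*} [MeasurableSpace Y] (q : Measure Y)
    [IsProbabilityMeasure q] {c B : ℝ} {n : ℕ} {g : (Fin n → Y) → ℝ} (hg : Measurable g)
    (hB : ∀ z, |g z| ≤ B) (hc : ∀ z i y, |g z - g (Function.update z i y)| ≤ c) {v : ℝ≥0}
    (hv : n * c ^ 2 / 4 ≤ v) :
    HasSubgaussianMGF (fun z => g z - ∫ z, g z ∂(Measure.pi fun _ => q)) v
      (Measure.pi fun _ => q) where
  integrable_exp_mul t := by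
    refine integrable_of_abs_le (B := Real.exp (|t| * (B + |∫ z, g z ∂(Measure.pi fun _ => q)|)))
      (by fun_prop) fun z => ?_
    rw [Real.abs_exp]
    refine Real.exp_le_exp.2 ((le_abs_self _).trans ?_)
    rw [abs_mul]
    exact mul_le_mul_of_nonneg_left
      ((abs_sub _ _).trans (add_le_add_left (hB z) _)) (abs_nonneg t)
  mgf_le t := by
    have h := integral_exp_le_of_bounded_differences q (g := fun z => t * g z) (B := |t| * B)
      (c := |t| * c) (hg.const_mul t)
      (fun z => by rw [abs_mul]; exact mul_le_mul_of_nonneg_left (hB z) (abs_nonneg t))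
      (fun z i y => by
        rw [← mul_sub, abs_mul]; exact mul_le_mul_of_nonneg_left (hc z i y) (abs_nonneg t))
    simp only [mgf, mul_sub, Real.exp_sub, integral_div]
    rw [div_le_iff₀ (Real.exp_pos _), ← Real.exp_add]
    refine h.trans (Real.exp_le_exp.2 ?_)
    rw [integral_const_mul, mul_pow, sq_abs]
    nlinarith [mul_le_mul_of_nonneg_right hv (sq_nonneg t)]

/-- A weighted sum of sub-Gaussian variables, without any assumption on their joint law. -/
theorem hasSubgaussianMGF_weighted_sum {Ω κ : Type*} [MeasurableSpace Ω] {P : Measure Ω}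
    [IsProbabilityMeasure P] {X : κ → Ω → ℝ} {w : κ → ℝ} {σ : κ → ℝ≥0} (hw : ∀ k, 0 ≤ w k)
    (hX : ∀ k, HasSubgaussianMGF (X k) (σ k ^ 2) P) (s : Finset κ) :
    HasSubgaussianMGF (fun ω => ∑ k ∈ s, w k * X k ω) ((∑ k ∈ s, (w k).toNNReal * σ k) ^ 2) P := by
  classical
  induction s using Finset.induction_on with
  | empty => simp
  | insert k s hk ih =>
    simp only [Finset.sum_insert hk]
    -- Without independence, square roots of variance proxies add, so the result is a squared sum
    -- and not a sum of squares.
    have h := ((hX k).const_mul (w k)).add ih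
    have e : NNReal.mk (w k ^ 2) (sq_nonneg _) * σ k ^ 2 = ((w k).toNNReal * σ k) ^ 2 := by
      ext
      push_cast
      rw [Real.coe_toNNReal _ (hw k), mul_pow]
    have h' : HasSubgaussianMGF (fun ω => w k * X k ω + ∑ k ∈ s, w k * X k ω)
        ((NNReal.sqrt (NNReal.mk (w k ^ 2) (sq_nonneg _) * σ k ^ 2) +
          NNReal.sqrt ((∑ k ∈ s, (w k).toNNReal * σ k) ^ 2)) ^ 2) P := h
    rwa [e, NNReal.sqrt_sq, NNReal.sqrt_sq] at h'

/-! ### Measurability of suprema over a class -/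

instance : MeasurableSingletonClass ℤˣ where
  measurableSet_singleton u :=
    ⟨{(u : ℤ)}, measurableSet_singleton _, by ext v; simp [Units.ext_iff]⟩

theorem IsMeasurableClass.measurableSet_exists_fintype {X ι : Type*} [MeasurableSpace X]
    [Fintype ι] {F : Set (X → ℝ)} (hF : IsMeasurableClass F) {U : Set (ι → ℝ)} (hU : IsOpen U) :
    MeasurableSet {x : ι → X | ∃ f ∈ F, (fun i => f (x i)) ∈ U} := by
  let e := Fintype.equivFin ι
  have h := hF.measurableSet_exists (Fintype.card ι) ((fun v i => v (e i)) ⁻¹' U)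
    (hU.preimage (by fun_prop))
  have hm : Measurable fun (x : ι → X) (j : Fin (Fintype.card ι)) => x (e.symm j) := by fun_prop
  simpa using hm h

theorem bddAbove_range_comp_class {X ι : Type*} [Fintype ι] {F : Set (X → ℝ)}
    {β : ℝ} (hbound : ∀ f ∈ F, ∀ h, |f h| ≤ β) {Ψ : (ι → ℝ) → ℝ} (hΨ : Continuous Ψ) (x : ι → X) :
    BddAbove (Set.range fun f : F => Ψ fun i => f.1 (x i)) := by
  have hK : IsCompact (Set.univ.pi fun _ : ι => Set.Icc (-β) β) :=
    isCompact_univ_pi fun _ => isCompact_Icc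
  refine (hK.image hΨ).bddAbove.mono ?_
  rintro _ ⟨f, rfl⟩
  exact ⟨_, fun i _ => abs_le.1 (hbound f.1 f.2 (x i)), rfl⟩

/-- The supremum exceeds c iff some member of the class sends the sample into the open set {Ψ > c},
which `IsMeasurableClass` covers. The discrete parameter in `Λ` (labels) is frozen one value at a
time. -/
theorem IsMeasurableClass.measurable_iSup {X ι W Λ : Type*} [MeasurableSpace X] [Fintype ι]
    [MeasurableSpace W] [MeasurableSpace Λ] [Countable Λ] [MeasurableSingletonClass Λ]
    {F : Set (X → ℝ)} (hF : IsMeasurableClass F) (hne : F.Nonempty) {β : ℝ}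
    (hbound : ∀ f ∈ F, ∀ h, |f h| ≤ β) {l : W → Λ} (hl : Measurable l) {x : W → ι → X}
    (hx : Measurable x) {Ψ : Λ → (ι → ℝ) → ℝ} (hΨ : ∀ a, Continuous (Ψ a)) :
    Measurable fun w => ⨆ f : F, Ψ (l w) fun i => f.1 (x w i) := by
  have : Nonempty F := hne.to_subtype
  have h : Measurable fun p : Λ × (ι → X) => ⨆ f : F, Ψ p.1 fun i => f.1 (p.2 i) := by
    refine measurable_from_prod_countable_right fun a => measurable_of_Ioi fun c => ?_
    convert! hF.measurableSet_exists_fintype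
      (isOpen_Ioi.preimage (hΨ a) : IsOpen (Ψ a ⁻¹' Set.Ioi c))
    ext y
    simp [lt_ciSup_iff (bddAbove_range_comp_class hbound (hΨ a) y)]
  exact h.comp (hl.prodMk hx)

theorem abs_iSup_sub_iSup_le {ι : Type*} [Nonempty ι] {u v : ι → ℝ} {c : ℝ}
    (hu : BddAbove (Set.range u)) (hv : BddAbove (Set.range v)) (h : ∀ t, |u t - v t| ≤ c) :
    |(⨆ t, u t) - ⨆ t, v t| ≤ c := by
  rw [abs_le, neg_le_sub_iff_le_add, sub_le_iff_le_add]
  constructor <;> refine ciSup_le fun t => ?_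
  · linarith [le_ciSup hu t, (abs_le.1 (h t)).1]
  · linarith [le_ciSup hv t, (abs_le.1 (h t)).2]

section Agent

variable {X : Type*} [MeasurableSpace X]

theorem trainingLaw_eq_add (L : ℤˣ → Measure X) : trainingLaw L =
    (1 / 2 : ℝ≥0∞) • (L 1).map (fun h => (h, (1 : ℤˣ))) +
      (1 / 2 : ℝ≥0∞) • (L (-1)).map (fun h => (h, (-1 : ℤˣ))) :=
  sum_intUnits _

instance (L : ℤˣ → Measure X) [∀ γ, IsProbabilityMeasure (L γ)] :
    IsProbabilityMeasure (trainingLaw L) where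
  measure_univ := by
    rw [trainingLaw_eq_add]
    simp [Measure.map_apply measurable_prodMk_right, ENNReal.inv_two_add_inv_two]

theorem integral_trainingLaw (L : ℤˣ → Measure X) [∀ γ, IsProbabilityMeasure (L γ)]
    {g : X × ℤˣ → ℝ} (hg : Measurable g) {B : ℝ} (hB : ∀ z, |g z| ≤ B) :
    ∫ z, g z ∂(trainingLaw L) = ((∫ h, g (h, 1) ∂(L 1)) + ∫ h, g (h, -1) ∂(L (-1))) / 2 := by
  have hm (γ : ℤˣ) : IsProbabilityMeasure ((L γ).map fun h => (h, γ)) :=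
    Measure.isProbabilityMeasure_map measurable_prodMk_right.aemeasurable
  have hi (γ : ℤˣ) : Integrable g ((1 / 2 : ℝ≥0∞) • (L γ).map fun h => (h, γ)) :=
    (integrable_of_abs_le hg hB).smul_measure (by simp)
  rw [trainingLaw_eq_add, integral_add_measure (hi 1) (hi (-1)), integral_smul_measure,
    integral_smul_measure, integral_map measurable_prodMk_right.aemeasurable hg.aestronglyMeasurable,
    integral_map measurable_prodMk_right.aemeasurable hg.aestronglyMeasurable]
  simp
  ring

/-! ### Deviations from an independent ghost sample -/

/-- A family `ψ γ` of continuous functions that vanish at zero and are Lipschitz with constant `C`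
on `[-β, β]`. -/
structure IsLipschitzFamily (ψ : ℤˣ → ℝ → ℝ) (C β : ℝ) : Prop where
  zero : ∀ γ, ψ γ 0 = 0
  continuous : ∀ γ, Continuous (ψ γ)
  lipschitz : ∀ γ, ∀ x ∈ Set.Icc (-β) β, ∀ y ∈ Set.Icc (-β) β, |ψ γ x - ψ γ y| ≤ C * |x - y|
  nonneg : 0 ≤ C

/-- Empirical average of `ψ γ (f h)`. -/
noncomputable def empAvg (ψ : ℤˣ → ℝ → ℝ) (f : X → ℝ) {n : ℕ} (z : Fin n → X × ℤˣ) : ℝ :=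
  (1 / (n : ℝ)) * ∑ i, ψ (z i).2 (f (z i).1)

/-- Largest difference of the empirical averages on two training sets. -/
noncomputable def supDiff (ψ : ℤˣ → ℝ → ℝ) (F : Set (X → ℝ)) {n : ℕ} (z z' : Fin n → X × ℤˣ) : ℝ :=
  ⨆ f : F, |empAvg ψ f.1 z' - empAvg ψ f.1 z|

/-- Mean over an independent ghost training set of the largest difference of empirical averages. -/
noncomputable def ghostDev (ψ : ℤˣ → ℝ → ℝ) (L : ℤˣ → Measure X) (F : Set (X → ℝ)) {n : ℕ}
    (z : Fin n → X × ℤˣ) : ℝ :=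
  ∫ z', supDiff ψ F z z' ∂(Measure.pi fun _ => trainingLaw L)

variable {ψ : ℤˣ → ℝ → ℝ} {C β : ℝ} {F : Set (X → ℝ)} {f : X → ℝ} {n : ℕ}

theorem IsLipschitzFamily.abs_apply_le (hψ : IsLipschitzFamily ψ C β) {v : ℝ} (hv : |v| ≤ β)
    (γ : ℤˣ) : |ψ γ v| ≤ C * |v| := by
  have hβ : 0 ≤ β := (abs_nonneg v).trans hv
  simpa [hψ.zero] using hψ.lipschitz γ v (abs_le.1 hv) 0 ⟨by linarith, hβ⟩

theorem IsLipschitzFamily.abs_le_mul (hψ : IsLipschitzFamily ψ C β) {v : ℝ} (hv : |v| ≤ β)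
    (γ : ℤˣ) : |ψ γ v| ≤ C * β :=
  (hψ.abs_apply_le hv γ).trans (mul_le_mul_of_nonneg_left hv hψ.nonneg)

theorem IsLipschitzFamily.measurable_comp (hψ : IsLipschitzFamily ψ C β) (hf : Measurable f) :
    Measurable fun z : X × ℤˣ => ψ z.2 (f z.1) :=
  measurable_from_prod_countable_left fun γ => (hψ.continuous γ).measurable.comp hf

theorem measurable_empAvg (hψ : IsLipschitzFamily ψ C β) (hf : Measurable f) :
    Measurable (empAvg ψ f (n := n)) := by
  have := hψ.measurable_comp hf
  exact (Finset.measurable_sum _ fun i _ => this.comp (measurable_pi_apply i)).const_mul _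

omit [MeasurableSpace X] in
theorem abs_empAvg_le (hψ : IsLipschitzFamily ψ C β) (hf : ∀ h, |f h| ≤ β) (hn : 0 < n)
    (z : Fin n → X × ℤˣ) : |empAvg ψ f z| ≤ C * β := by
  have hn' : (0 : ℝ) < n := Nat.cast_pos.2 hn
  rw [empAvg, abs_mul, abs_of_nonneg (by positivity), one_div, inv_mul_le_iff₀ hn']
  refine (Finset.abs_sum_le_sum_abs _ _).trans ?_
  simpa using Finset.sum_le_sum fun i (_ : i ∈ Finset.univ) =>
    hψ.abs_le_mul (hf (z i).1) (z i).2

omit [MeasurableSpace X] in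
theorem abs_empAvg_sub_empAvg_le (hψ : IsLipschitzFamily ψ C β) (hf : ∀ h, |f h| ≤ β) (hn : 0 < n)
    (z z' : Fin n → X × ℤˣ) : |empAvg ψ f z' - empAvg ψ f z| ≤ 2 * (C * β) :=
  (abs_sub _ _).trans (by linarith [abs_empAvg_le hψ hf hn z, abs_empAvg_le hψ hf hn z'])

omit [MeasurableSpace X] in
theorem abs_empAvg_sub_empAvg_update_le (hψ : IsLipschitzFamily ψ C β) (hf : ∀ h, |f h| ≤ β)
    (z : Fin n → X × ℤˣ) (i : Fin n) (y : X × ℤˣ) :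
    |empAvg ψ f z - empAvg ψ f (Function.update z i y)| ≤ 2 * (C * β) / n := by
  have hs : ∑ j, ψ (z j).2 (f (z j).1) -
      ∑ j, ψ (Function.update z i y j).2 (f (Function.update z i y j).1) =
        ψ (z i).2 (f (z i).1) - ψ y.2 (f y.1) := by
    rw [← Finset.sum_sub_distrib, Finset.sum_eq_single i]
    · simp
    · intro j _ hj
      simp [Function.update_of_ne hj]
    · simp
  rw [empAvg, empAvg, ← mul_sub, hs, abs_mul, abs_of_nonneg (by positivity), one_div_mul_eq_div]
  gcongr
  exact (abs_sub _ _).trans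
    (by linarith [hψ.abs_le_mul (hf (z i).1) (z i).2, hψ.abs_le_mul (hf y.1) y.2])

omit [MeasurableSpace X] in
theorem bddAbove_abs_empAvg_sub (hψ : IsLipschitzFamily ψ C β) (hbound : ∀ f ∈ F, ∀ h, |f h| ≤ β)
    (hn : 0 < n) (z z' : Fin n → X × ℤˣ) :
    BddAbove (Set.range fun f : F => |empAvg ψ f.1 z' - empAvg ψ f.1 z|) :=
  bddAbove_range_of_abs_le fun f => by
    rw [abs_abs]; exact abs_empAvg_sub_empAvg_le hψ (hbound f.1 f.2) hn z z'

omit [MeasurableSpace X] in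
theorem supDiff_nonneg (z z' : Fin n → X × ℤˣ) : 0 ≤ supDiff ψ F z z' :=
  Real.iSup_nonneg fun _ => abs_nonneg _

omit [MeasurableSpace X] in
theorem abs_supDiff_le (hψ : IsLipschitzFamily ψ C β) (hne : F.Nonempty)
    (hbound : ∀ f ∈ F, ∀ h, |f h| ≤ β) (hn : 0 < n) (z z' : Fin n → X × ℤˣ) :
    |supDiff ψ F z z'| ≤ 2 * (C * β) := by
  have : Nonempty F := hne.to_subtype
  rw [abs_of_nonneg (supDiff_nonneg z z')]
  exact ciSup_le fun f => abs_empAvg_sub_empAvg_le hψ (hbound f.1 f.2) hn z z'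

theorem measurable_supDiff (hψ : IsLipschitzFamily ψ C β) (hF : IsMeasurableClass F)
    (hne : F.Nonempty) (hbound : ∀ f ∈ F, ∀ h, |f h| ≤ β) :
    Measurable fun p : (Fin n → X × ℤˣ) × (Fin n → X × ℤˣ) => supDiff ψ F p.1 p.2 := by
  have hc := hψ.continuous
  exact hF.measurable_iSup (ι := Fin n ⊕ Fin n) hne hbound
    (l := fun p : (Fin n → X × ℤˣ) × (Fin n → X × ℤˣ) => (fun i => (p.1 i).2, fun i => (p.2 i).2))
    (by fun_prop) (x := fun p => Sum.elim (fun i => (p.1 i).1) fun i => (p.2 i).1)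
    (measurable_pi_iff.2
      (by rintro (i | i) <;> simp only [Sum.elim_inl, Sum.elim_inr] <;> fun_prop))
    (Ψ := fun a v => |(1 / (n : ℝ)) * ∑ i, ψ (a.2 i) (v (.inr i)) -
      (1 / (n : ℝ)) * ∑ i, ψ (a.1 i) (v (.inl i))|)
    (fun a => by fun_prop)

section ghostDev

variable (L : ℤˣ → Measure X) [∀ γ, IsProbabilityMeasure (L γ)]

theorem integrable_supDiff (hψ : IsLipschitzFamily ψ C β) (hF : IsMeasurableClass F)
    (hne : F.Nonempty) (hbound : ∀ f ∈ F, ∀ h, |f h| ≤ β) (hn : 0 < n) (z : Fin n → X × ℤˣ) :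
    Integrable (supDiff ψ F z) (Measure.pi fun _ => trainingLaw L) :=
  have hm : Measurable (supDiff ψ F z) :=
    (measurable_supDiff hψ hF hne hbound (n := n)).of_uncurry_left
  integrable_of_abs_le hm (abs_supDiff_le hψ hne hbound hn z)

theorem measurable_ghostDev (hψ : IsLipschitzFamily ψ C β) (hF : IsMeasurableClass F)
    (hne : F.Nonempty) (hbound : ∀ f ∈ F, ∀ h, |f h| ≤ β) :
    Measurable (ghostDev ψ L F (n := n)) :=
  (measurable_supDiff hψ hF hne hbound).stronglyMeasurable.integral_prod_right'.measurable

theorem abs_ghostDev_le (hψ : IsLipschitzFamily ψ C β) (hne : F.Nonempty)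
    (hbound : ∀ f ∈ F, ∀ h, |f h| ≤ β) (hn : 0 < n) (z : Fin n → X × ℤˣ) :
    |ghostDev ψ L F z| ≤ 2 * (C * β) := by
  simpa [ghostDev] using norm_integral_le_of_norm_le_const
    (μ := Measure.pi fun _ : Fin n => trainingLaw L) (f := supDiff ψ F z)
    (.of_forall fun z' => abs_supDiff_le hψ hne hbound hn z z')

/-- Changing one training pair moves every empirical average by at most c = 2Cβ/n, a bound that
survives the supremum and the ghost integral; n c²/4 = (Cβ)²/n. -/
theorem hasSubgaussianMGF_ghostDev (hψ : IsLipschitzFamily ψ C β) (hF : IsMeasurableClass F)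
    (hne : F.Nonempty) (hbound : ∀ f ∈ F, ∀ h, |f h| ≤ β) (hn : 0 < n) {v : ℝ≥0}
    (hv : (C * β) ^ 2 / n ≤ v) :
    HasSubgaussianMGF (fun z : Fin n → X × ℤˣ => ghostDev ψ L F z -
      ∫ z : Fin n → X × ℤˣ, ghostDev ψ L F z ∂(Measure.pi fun _ => trainingLaw L)) v
      (Measure.pi fun _ => trainingLaw L) := by
  have : Nonempty F := hne.to_subtype
  refine hasSubgaussianMGF_of_bounded_differences (trainingLaw L) (c := 2 * (C * β) / n)
    (measurable_ghostDev L hψ hF hne hbound) (abs_ghostDev_le L hψ hne hbound hn) ?_ ?_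
  · intro z i y
    rw [ghostDev, ghostDev, ← integral_sub (integrable_supDiff L hψ hF hne hbound hn _)
      (integrable_supDiff L hψ hF hne hbound hn _)]
    have := norm_integral_le_of_norm_le_const (μ := Measure.pi fun _ : Fin n => trainingLaw L)
      (f := fun z' => supDiff ψ F z z' - supDiff ψ F (Function.update z i y) z')
      (C := 2 * (C * β) / n) (.of_forall fun z' => abs_iSup_sub_iSup_le
        (bddAbove_abs_empAvg_sub hψ hbound hn _ _) (bddAbove_abs_empAvg_sub hψ hbound hn _ _)
        fun f => (abs_abs_sub_abs_le_abs_sub _ _).trans ?_)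
    · simpa using this
    · rw [sub_sub_sub_cancel_left, abs_sub_comm]
      exact abs_empAvg_sub_empAvg_update_le hψ (hbound f.1 f.2) z i y
  · refine le_trans (le_of_eq ?_) hv
    have : (n : ℝ) ≠ 0 := by positivity
    field_simp
    ring

theorem integral_empAvg (hψ : IsLipschitzFamily ψ C β) (hfm : Measurable f)
    (hf : ∀ h, |f h| ≤ β) (hn : 0 < n) :
    ∫ z, empAvg ψ f z ∂(Measure.pi fun _ : Fin n => trainingLaw L) =
      ∫ z, ψ z.2 (f z.1) ∂(trainingLaw L) := by
  have hm := hψ.measurable_comp hfm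
  have hmp (i : Fin n) := measurePreserving_eval (fun _ : Fin n => trainingLaw L) i
  have hone (i : Fin n) : ∫ z : Fin n → X × ℤˣ, ψ (z i).2 (f (z i).1)
      ∂(Measure.pi fun _ : Fin n => trainingLaw L) = ∫ z, ψ z.2 (f z.1) ∂(trainingLaw L) := by
    conv_rhs => rw [← (hmp i).map_eq]
    rw [integral_map (hmp i).aemeasurable hm.aestronglyMeasurable]
  simp only [empAvg]
  rw [integral_const_mul, integral_finsetSum]
  · have : (n : ℝ) ≠ 0 := by positivity
    simp only [hone, Finset.sum_const, Finset.card_univ, Fintype.card_fin, nsmul_eq_mul]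
    field_simp
  · exact fun i _ => integrable_of_abs_le (hm.comp (measurable_pi_apply i))
      fun z => hψ.abs_le_mul (hf _) _

/-- The expectation is the mean of the ghost average, so the absolute value moves inside the ghost
integral. Unlike the supremum of the left side, `ghostDev` involves only finitely many values of `f`
at a time, which makes it measurable. -/
theorem abs_integral_sub_empAvg_le_ghostDev (hψ : IsLipschitzFamily ψ C β)
    (hF : IsMeasurableClass F) (hbound : ∀ f ∈ F, ∀ h, |f h| ≤ β) (hn : 0 < n) (hf : f ∈ F)
    (z : Fin n → X × ℤˣ) :
    |(∫ z, ψ z.2 (f z.1) ∂(trainingLaw L)) - empAvg ψ f z| ≤ ghostDev ψ L F z := by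
  have hfm := hF.measurable f hf
  have hi : Integrable (empAvg ψ f) (Measure.pi fun _ : Fin n => trainingLaw L) :=
    integrable_of_abs_le (measurable_empAvg hψ hfm) (abs_empAvg_le hψ (hbound f hf) hn)
  have e : (∫ z, ψ z.2 (f z.1) ∂(trainingLaw L)) - empAvg ψ f z =
      ∫ z', (empAvg ψ f z' - empAvg ψ f z) ∂(Measure.pi fun _ : Fin n => trainingLaw L) := by
    rw [integral_sub hi (integrable_const _), integral_empAvg L hψ hfm (hbound f hf) hn]
    simp
  rw [e]
  refine (abs_integral_le_integral_abs).trans (integral_mono (hi.sub (integrable_const _)).abs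
    (integrable_supDiff L hψ hF ⟨f, hf⟩ hbound hn z) fun z' => ?_)
  exact le_ciSup (bddAbove_abs_empAvg_sub hψ hbound hn z z') ⟨f, hf⟩

/-! ### Symmetrization -/

/-- Largest absolute correlation of the family `ψ γ (f h)`, `f ∈ F`, with the signs `r`. -/
noncomputable def supSigned (ψ : ℤˣ → ℝ → ℝ) (F : Set (X → ℝ)) (r : Fin n → ℤˣ)
    (z : Fin n → X × ℤˣ) : ℝ :=
  ⨆ f : F, |(1 / (n : ℝ)) * ∑ i, sgn (r i) * ψ (z i).2 (f.1 (z i).1)|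

omit [MeasurableSpace X] in
theorem abs_signed_le (hψ : IsLipschitzFamily ψ C β) (hf : ∀ h, |f h| ≤ β) (hn : 0 < n)
    (r : Fin n → ℤˣ) (z : Fin n → X × ℤˣ) :
    |(1 / (n : ℝ)) * ∑ i, sgn (r i) * ψ (z i).2 (f (z i).1)| ≤ C * β := by
  have hn' : (0 : ℝ) < n := Nat.cast_pos.2 hn
  rw [abs_mul, abs_of_nonneg (by positivity), one_div, inv_mul_le_iff₀ hn']
  refine (abs_sum_sgn_mul_le _ _).trans ?_
  simpa using Finset.sum_le_sum fun i (_ : i ∈ Finset.univ) =>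
    hψ.abs_le_mul (hf (z i).1) (z i).2

omit [MeasurableSpace X] in
theorem bddAbove_signed (hψ : IsLipschitzFamily ψ C β) (hbound : ∀ f ∈ F, ∀ h, |f h| ≤ β)
    (hn : 0 < n) (r : Fin n → ℤˣ) (z : Fin n → X × ℤˣ) :
    BddAbove (Set.range fun f : F =>
      |(1 / (n : ℝ)) * ∑ i, sgn (r i) * ψ (z i).2 (f.1 (z i).1)|) :=
  bddAbove_range_of_abs_le fun f => by
    rw [abs_abs]; exact abs_signed_le hψ (hbound f.1 f.2) hn r z

omit [MeasurableSpace X] in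
theorem abs_supSigned_le (hψ : IsLipschitzFamily ψ C β) (hne : F.Nonempty)
    (hbound : ∀ f ∈ F, ∀ h, |f h| ≤ β) (hn : 0 < n) (r : Fin n → ℤˣ) (z : Fin n → X × ℤˣ) :
    |supSigned ψ F r z| ≤ C * β := by
  have : Nonempty F := hne.to_subtype
  rw [supSigned, abs_of_nonneg (Real.iSup_nonneg fun _ => abs_nonneg _)]
  exact ciSup_le fun f => abs_signed_le hψ (hbound f.1 f.2) hn r z

theorem measurable_supSigned (hψ : IsLipschitzFamily ψ C β) (hF : IsMeasurableClass F)
    (hne : F.Nonempty) (hbound : ∀ f ∈ F, ∀ h, |f h| ≤ β) (r : Fin n → ℤˣ) :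
    Measurable (supSigned ψ F r) := by
  have hc := hψ.continuous
  exact hF.measurable_iSup hne hbound
    (l := fun (z : Fin n → X × ℤˣ) i => (z i).2) (by fun_prop)
    (x := fun z i => (z i).1) (by fun_prop)
    (Ψ := fun a v => |(1 / (n : ℝ)) * ∑ i, sgn (r i) * ψ (a i) (v i)|) (fun a => by fun_prop)

/-- Swapping the i-th training and ghost pairs wherever r i = -1 preserves the joint law and puts
the sign r i on the i-th difference. The triangle inequality leaves two terms of equal mean. This
holds for each fixed `r`; averaging comes later. -/
theorem integral_ghostDev_le_integral_supSigned (hψ : IsLipschitzFamily ψ C β)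
    (hF : IsMeasurableClass F) (hne : F.Nonempty) (hbound : ∀ f ∈ F, ∀ h, |f h| ≤ β) (hn : 0 < n)
    (r : Fin n → ℤˣ) :
    ∫ z : Fin n → X × ℤˣ, ghostDev ψ L F z ∂(Measure.pi fun _ => trainingLaw L) ≤
      2 * ∫ z : Fin n → X × ℤˣ, supSigned ψ F r z ∂(Measure.pi fun _ => trainingLaw L) := by
  have : Nonempty F := hne.to_subtype
  set q := trainingLaw L
  set μ : Measure (Fin n → X × ℤˣ) := Measure.pi fun _ => q
  let S : (Fin n → (X × ℤˣ) × (X × ℤˣ)) → Fin n → (X × ℤˣ) × (X × ℤˣ) :=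
    fun w i => if r i = 1 then w i else (w i).swap
  have hS : MeasurePreserving S (Measure.pi fun _ => q.prod q) (Measure.pi fun _ => q.prod q) := by
    refine measurePreserving_pi (fun _ => q.prod q) (fun _ => q.prod q)
      (f := fun i p => if r i = 1 then p else p.swap) fun i => ?_
    by_cases h : r i = 1
    · simpa only [h, if_true] using! MeasurePreserving.id (q.prod q)
    · simpa [h] using Measure.measurePreserving_swap
  have hA := measurePreserving_arrowProdEquivProdArrow (X × ℤˣ) (X × ℤˣ) (Fin n)
    (fun _ => q) (fun _ => q)
  have hmS := measurable_supDiff hψ hF hne hbound (n := n)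
  have hB : Integrable (fun p : (Fin n → X × ℤˣ) × (Fin n → X × ℤˣ) => supDiff ψ F p.1 p.2)
      (μ.prod μ) :=
    integrable_of_abs_le hmS fun p => abs_supDiff_le hψ hne hbound hn _ _
  have hTi : Integrable (supSigned ψ F r) μ :=
    integrable_of_abs_le (measurable_supSigned hψ hF hne hbound r)
      (abs_supSigned_le hψ hne hbound hn r)
  have hAi : Integrable (fun w : Fin n → (X × ℤˣ) × (X × ℤˣ) =>
      supDiff ψ F (fun i => (w i).1) fun i => (w i).2) (Measure.pi fun _ => q.prod q) :=
    (hA.integrable_comp_emb (MeasurableEquiv.measurableEmbedding _)).2 hB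
  have e : ∫ z, ghostDev ψ L F z ∂μ = ∫ w : Fin n → (X × ℤˣ) × (X × ℤˣ),
      supDiff ψ F (fun i => (S w i).1) (fun i => (S w i).2) ∂(Measure.pi fun _ => q.prod q) := by
    calc ∫ z, ghostDev ψ L F z ∂μ = ∫ p, supDiff ψ F p.1 p.2 ∂(μ.prod μ) :=
          (integral_prod _ hB).symm
      _ = ∫ w : Fin n → (X × ℤˣ) × (X × ℤˣ), supDiff ψ F (fun i => (w i).1) (fun i => (w i).2)
            ∂(Measure.pi fun _ => q.prod q) :=
          (hA.integral_comp' fun p : (Fin n → X × ℤˣ) × (Fin n → X × ℤˣ) =>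
            supDiff ψ F p.1 p.2).symm
      _ = _ := by
          conv_lhs => rw [← hS.map_eq]
          rw [integral_map hS.aemeasurable]
          rw [hS.map_eq]
          exact hAi.aestronglyMeasurable
  have hle (w : Fin n → (X × ℤˣ) × (X × ℤˣ)) :
      supDiff ψ F (fun i => (S w i).1) (fun i => (S w i).2) ≤
        supSigned ψ F r (fun i => (w i).2) + supSigned ψ F r (fun i => (w i).1) := by
    refine ciSup_le fun f => ?_
    have e : empAvg ψ f.1 (fun i => (S w i).2) - empAvg ψ f.1 (fun i => (S w i).1) =
        (1 / (n : ℝ)) * ∑ i, sgn (r i) * ψ (w i).2.2 (f.1 (w i).2.1) -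
          (1 / (n : ℝ)) * ∑ i, sgn (r i) * ψ (w i).1.2 (f.1 (w i).1.1) := by
      simp only [empAvg, ← mul_sub, ← Finset.sum_sub_distrib]
      congr 1
      refine Finset.sum_congr rfl fun i _ => ?_
      rcases Int.units_eq_one_or (r i) with h | h <;> simp [S, h, sgn]
    rw [e]
    exact (abs_sub _ _).trans (add_le_add
      (le_ciSup (bddAbove_signed hψ hbound hn r fun i => (w i).2) f)
      (le_ciSup (bddAbove_signed hψ hbound hn r fun i => (w i).1) f))
  have hfst : Integrable (fun p : (Fin n → X × ℤˣ) × (Fin n → X × ℤˣ) => supSigned ψ F r p.1)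
      (μ.prod μ) := hTi.comp_fst μ
  have hsnd : Integrable (fun p : (Fin n → X × ℤˣ) × (Fin n → X × ℤˣ) => supSigned ψ F r p.2)
      (μ.prod μ) := hTi.comp_snd μ
  have hsum : Integrable (fun w : Fin n → (X × ℤˣ) × (X × ℤˣ) =>
      supSigned ψ F r (fun i => (w i).2) + supSigned ψ F r (fun i => (w i).1))
      (Measure.pi fun _ => q.prod q) :=
    (hA.integrable_comp_emb (MeasurableEquiv.measurableEmbedding _)).2 (hsnd.add hfst)
  rw [e]
  calc _ ≤ ∫ w : Fin n → (X × ℤˣ) × (X × ℤˣ), (supSigned ψ F r (fun i => (w i).2) +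
          supSigned ψ F r (fun i => (w i).1)) ∂(Measure.pi fun _ => q.prod q) :=
        integral_mono ((hS.integrable_comp hAi.aestronglyMeasurable).2 hAi) hsum hle
    _ = ∫ p : (Fin n → X × ℤˣ) × (Fin n → X × ℤˣ),
          (supSigned ψ F r p.2 + supSigned ψ F r p.1) ∂(μ.prod μ) :=
        hA.integral_comp' fun p : (Fin n → X × ℤˣ) × (Fin n → X × ℤˣ) =>
            supSigned ψ F r p.2 + supSigned ψ F r p.1
    _ = 2 * ∫ z, supSigned ψ F r z ∂μ := by
        rw [integral_add hsnd hfst, integral_fun_fst, integral_fun_snd]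
        simp
        ring

-- With the labels fixed, ψ (γ i) (f (h i)) is a contraction of C f (h i), by a map that may vary
-- with i.
omit [MeasurableSpace X] in
theorem sum_supSigned_le (hψ : IsLipschitzFamily ψ C β) (hne : F.Nonempty)
    (hbound : ∀ f ∈ F, ∀ h, |f h| ≤ β) (z : Fin n → X × ℤˣ) :
    (1 / (2 : ℝ) ^ n) * ∑ r : Fin n → ℤˣ, supSigned ψ F r z ≤
      2 * C * empRademacher F fun i => (z i).1 := by
  have : Nonempty F := hne.to_subtype
  have h := sum_ciSup_abs_contraction (ι := F) (n := n) (a := fun i f => C * f.1 (z i).1)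
    (b := fun i f => ψ (z i).2 (f.1 (z i).1)) (C := C * β)
    (fun i f => by
      rw [abs_mul, abs_of_nonneg hψ.nonneg]
      exact mul_le_mul_of_nonneg_left (hbound f.1 f.2 _) hψ.nonneg)
    (fun i f => by
      rw [abs_mul, abs_of_nonneg hψ.nonneg]
      exact hψ.abs_apply_le (hbound f.1 f.2 _) _)
    (fun i f g => by
      rw [← mul_sub, abs_mul, abs_of_nonneg hψ.nonneg]
      exact hψ.lipschitz _ _ (abs_le.1 (hbound f.1 f.2 _)) _ (abs_le.1 (hbound g.1 g.2 _)))
  have hn : 0 ≤ 1 / (n : ℝ) := by positivity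
  have e (r : Fin n → ℤˣ) (f : F) : |∑ i, sgn (r i) * (C * f.1 (z i).1)| =
      C * |∑ i, sgn (r i) * f.1 (z i).1| := by
    simp only [mul_left_comm _ C, ← Finset.mul_sum]
    rw [abs_mul, abs_of_nonneg hψ.nonneg]
  simp only [e, ← Real.mul_iSup_of_nonneg hψ.nonneg, ← Finset.mul_sum] at h
  simp only [supSigned, empRademacher, abs_mul (1 / (n : ℝ)), abs_of_nonneg hn,
    ← Real.mul_iSup_of_nonneg hn, ← Finset.mul_sum]
  have := mul_le_mul_of_nonneg_left h (show 0 ≤ (1 / (2 : ℝ) ^ n) * (1 / (n : ℝ)) by positivity)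
  linarith

theorem measurable_empRademacher (hF : IsMeasurableClass F) (hne : F.Nonempty)
    (hbound : ∀ f ∈ F, ∀ h, |f h| ≤ β) : Measurable (empRademacher F (n := n)) := by
  refine (Finset.measurable_sum _ fun r _ => ?_).const_mul _
  exact hF.measurable_iSup hne hbound (l := fun _ : Fin n → X => ()) measurable_const
    (x := fun h => h) measurable_id
    (Ψ := fun _ v => |(1 / (n : ℝ)) * ∑ i, sgn (r i) * v i|) (fun _ => by fun_prop)

theorem integral_ghostDev_le_rademacher (hψ : IsLipschitzFamily ψ C β) (hF : IsMeasurableClass F)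
    (hne : F.Nonempty) (hbound : ∀ f ∈ F, ∀ h, |f h| ≤ β) (hn : 0 < n) :
    ∫ z : Fin n → X × ℤˣ, ghostDev ψ L F z ∂(Measure.pi fun _ => trainingLaw L) ≤
      4 * C * rademacher L F n := by
  have hm := measurable_empRademacher hF hne hbound (n := n)
  have hfst : Measurable fun (z : Fin n → X × ℤˣ) i => (z i).1 := by fun_prop
  have hmap : (Measure.pi fun _ : Fin n => trainingLaw L).map (fun z i => (z i).1) =
      Measure.pi fun _ => (trainingLaw L).fst :=
    Measure.pi_map_pi (μ := fun _ : Fin n => trainingLaw L) (f := fun _ => Prod.fst)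
      fun _ => measurable_fst.aemeasurable
  have hi r : Integrable (supSigned ψ F r) (Measure.pi fun _ : Fin n => trainingLaw L) :=
    integrable_of_abs_le (measurable_supSigned hψ hF hne hbound r)
      (abs_supSigned_le hψ hne hbound hn r)
  have hid : IsLipschitzFamily (fun _ v => v) 1 β :=
    ⟨fun _ => rfl, fun _ => continuous_id, fun _ x _ y _ => by simp, zero_le_one⟩
  have hEi : Integrable (fun z : Fin n → X × ℤˣ => empRademacher F fun i => (z i).1)
      (Measure.pi fun _ : Fin n => trainingLaw L) := by
    have hi' r : Integrable (supSigned (fun _ v => v) F r)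
        (Measure.pi fun _ : Fin n => trainingLaw L) :=
      integrable_of_abs_le (measurable_supSigned hid hF hne hbound r)
        (abs_supSigned_le hid hne hbound hn r)
    exact (integrable_finsetSum _ fun r _ => hi' r).const_mul _
  have hcard : (1 / (2 : ℝ) ^ n) * ∑ r : Fin n → ℤˣ, (1 : ℝ) = 1 := by
    simp
  calc _ = (1 / (2 : ℝ) ^ n) * ∑ r : Fin n → ℤˣ,
        ∫ z : Fin n → X × ℤˣ, ghostDev ψ L F z ∂(Measure.pi fun _ => trainingLaw L) := by
        rw [← one_mul (∫ z, ghostDev ψ L F z ∂_), ← hcard, mul_assoc, Finset.sum_mul]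
        simp
    _ ≤ (1 / (2 : ℝ) ^ n) * ∑ r : Fin n → ℤˣ, 2 *
        ∫ z : Fin n → X × ℤˣ, supSigned ψ F r z ∂(Measure.pi fun _ => trainingLaw L) := by
        gcongr with r
        exact integral_ghostDev_le_integral_supSigned L hψ hF hne hbound hn r
    _ = 2 * ∫ z : Fin n → X × ℤˣ, (1 / (2 : ℝ) ^ n) * ∑ r : Fin n → ℤˣ, supSigned ψ F r z
          ∂(Measure.pi fun _ => trainingLaw L) := by
        rw [integral_const_mul, integral_finsetSum _ fun r _ => hi r, ← Finset.mul_sum]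
        ring
    _ ≤ 2 * ∫ z : Fin n → X × ℤˣ, 2 * C * empRademacher F (fun i => (z i).1)
          ∂(Measure.pi fun _ => trainingLaw L) := by
        refine mul_le_mul_of_nonneg_left (integral_mono
          ((integrable_finsetSum _ fun r _ => hi r).const_mul _) (hEi.const_mul _) fun z => ?_)
          zero_le_two
        exact sum_supSigned_le hψ hne hbound z
    _ = 4 * C * rademacher L F n := by
        rw [integral_const_mul, rademacher, ← hmap,
          integral_map hfst.aemeasurable hm.aestronglyMeasurable]
        ring

end ghostDev

end Agent

/-! ### The loss function -/

section Loss

variable {φ : ℝ → ℝ} {Lip : ℝ≥0} {β : ℝ}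

theorem IsLoss.continuous (hφ : IsLoss φ Lip β) : Continuous φ :=
  continuousOn_univ.1 (hφ.convex.continuousOn isOpen_univ)

/-- Constant 0 would make φ constant near 0, against φ'(0) < 0. -/
theorem IsLoss.lip_pos (hφ : IsLoss φ Lip β) (hβ : 0 < β) : 0 < (Lip : ℝ) := by
  by_contra h
  have h0 : (Lip : ℝ) = 0 := le_antisymm (not_lt.1 h) Lip.2
  have hconst : φ =ᶠ[nhds 0] fun _ => φ 0 := by
    filter_upwards [Icc_mem_nhds (neg_lt_zero.2 hβ) hβ] with x hx
    have := hφ.lipschitz.dist_le_mul x hx 0 ⟨by linarith, hβ.le⟩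
    rw [h0, zero_mul] at this
    exact dist_le_zero.1 this
  have := hφ.deriv_zero_neg
  rw [hconst.deriv_eq, deriv_const] at this
  exact lt_irrefl _ this

theorem isLipschitzFamily_id : IsLipschitzFamily (fun _ v => v) 1 β :=
  ⟨fun _ => rfl, fun _ => continuous_id, fun _ x _ y _ => by simp, zero_le_one⟩

theorem IsLoss.isLipschitzFamily (hφ : IsLoss φ Lip β) :
    IsLipschitzFamily (fun γ v => φ (sgn γ * v) - φ 0) Lip β where
  zero γ := by simp
  continuous γ := by have := hφ.continuous; fun_prop
  lipschitz γ x hx y hy := by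
    have hmem {v : ℝ} (hv : v ∈ Set.Icc (-β) β) : sgn γ * v ∈ Set.Icc (-β) β :=
      abs_le.1 (by rw [abs_mul, abs_sgn, one_mul]; exact abs_le.2 hv)
    have := hφ.lipschitz.dist_le_mul _ (hmem hx) _ (hmem hy)
    rwa [Real.dist_eq, Real.dist_eq, ← mul_sub, abs_mul, abs_sgn, one_mul,
      ← sub_sub_sub_cancel_right _ _ (φ 0)] at this
  nonneg := Lip.2

theorem IsLoss.existsUnique_criticalFun_eq_zero (hφ : IsLoss φ Lip β) (hLip : 0 < (Lip : ℝ))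
    {R : ℝ} (hR : R < φ 0) :
    (∃! d, criticalFun φ Lip R d = 0) ∧ ∀ d, criticalFun φ Lip R d = 0 → 0 < d := by
  have hmono : StrictMono (criticalFun φ Lip R) := fun x y hxy => by
    have := div_le_div_of_nonneg_right (sub_le_sub_right (hφ.antitone hxy.le) R)
      (show 0 ≤ 2 * (Lip : ℝ) by positivity)
    simp only [criticalFun]
    linarith
  have hcont : Continuous (criticalFun φ Lip R) := by
    have := hφ.continuous
    unfold criticalFun
    fun_prop
  -- The zero lies in [0, D]: the function is -D at 0, and φ D ≤ φ 0 makes it nonnegative at D.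
  set D := (φ 0 - R) / (2 * (Lip : ℝ)) with hD
  have hDpos : 0 < D := div_pos (by linarith) (by positivity)
  have h0 : criticalFun φ Lip R 0 < 0 := by
    simp only [criticalFun, ← hD]
    linarith
  have h1 : 0 ≤ criticalFun φ Lip R D := by
    have := div_le_div_of_nonneg_right (sub_le_sub_right (hφ.antitone hDpos.le) R)
      (show 0 ≤ 2 * (Lip : ℝ) by positivity)
    simp only [criticalFun]
    linarith
  obtain ⟨d, -, hd⟩ := intermediate_value_Icc hDpos.le hcont.continuousOn ⟨h0.le, h1⟩
  refine ⟨⟨d, hd, fun d' hd' => hmono.injective (hd'.trans hd.symm)⟩, fun d hd => ?_⟩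
  exact hmono.lt_iff_lt.1 (hd ▸ h0)

end Loss

/-! ### Means and risks of one agent -/

section Agent

variable {X : Type*} [MeasurableSpace X] (L : ℤˣ → Measure X) [∀ γ, IsProbabilityMeasure (L γ)]
  {φ : ℝ → ℝ} {Lip : ℝ≥0} {β : ℝ} {F : Set (X → ℝ)} {f : X → ℝ} {n : ℕ}

theorem abs_condMean_sub_empMean_le (hF : IsMeasurableClass F) (hbound : ∀ f ∈ F, ∀ h, |f h| ≤ β)
    (hn : 0 < n) (hf : f ∈ F) (z : Fin n → X × ℤˣ) :
    |(condMean L 1 f + condMean L (-1) f) / 2 - empMean z f| ≤ ghostDev (fun _ v => v) L F z := by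
  have := abs_integral_sub_empAvg_le_ghostDev L isLipschitzFamily_id hF hbound hn hf z
  rwa [integral_trainingLaw L (g := fun z => f z.1) ((hF.measurable f hf).comp measurable_fst)
    fun z => hbound f hf z.1] at this

theorem abs_risk_sub_empRisk_le (hφ : IsLoss φ Lip β) (hF : IsMeasurableClass F)
    (hbound : ∀ f ∈ F, ∀ h, |f h| ≤ β) (hn : 0 < n) (hf : f ∈ F) (z : Fin n → X × ℤˣ) :
    |risk φ L f - empRisk φ z f| ≤ ghostDev (fun γ v => φ (sgn γ * v) - φ 0) L F z := by
  have hψ := hφ.isLipschitzFamily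
  have h := abs_integral_sub_empAvg_le_ghostDev L hψ hF hbound hn hf z
  have hi : Integrable (fun z : X × ℤˣ => φ (sgn z.2 * f z.1) - φ 0) (trainingLaw L) :=
    integrable_of_abs_le (hψ.measurable_comp (hF.measurable f hf))
      fun z => hψ.abs_le_mul (hbound f hf z.1) z.2
  have e1 : risk φ L f = (∫ z, (φ (sgn z.2 * f z.1) - φ 0) ∂(trainingLaw L)) + φ 0 := by
    have h' := integral_add hi (integrable_const (φ 0))
    simpa [risk] using h'
  have e2 : empRisk φ z f = empAvg (fun γ v => φ (sgn γ * v) - φ 0) f z + φ 0 := by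
    have : (n : ℝ) ≠ 0 := by positivity
    simp only [empRisk, empAvg, Finset.sum_sub_distrib, Finset.sum_const, Finset.card_univ,
      Fintype.card_fin, nsmul_eq_mul]
    field_simp
    ring
  rwa [e1, e2, add_sub_add_right_eq_sub]

/-- The deviation is paid twice: for `f`, and for an arbitrary competitor, so the infimum need not
be attained. -/
theorem risk_le_targetRisk_add (hφ : IsLoss φ Lip β) (hF : IsMeasurableClass F)
    (hbound : ∀ f ∈ F, ∀ h, |f h| ≤ β) (hn : 0 < n) {z : Fin n → X × ℤˣ}
    (hf : IsTrained φ F z f) :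
    risk φ L f ≤ targetRisk φ L F +
      2 * ghostDev (fun γ v => φ (sgn γ * v) - φ 0) L F z := by
  have : Nonempty F := ⟨⟨f, hf.mem⟩⟩
  rw [← sub_le_iff_le_add]
  refine le_ciInf fun g => ?_
  have h1 := (abs_le.1 (abs_risk_sub_empRisk_le L hφ hF hbound hn hf.mem z)).2
  have h2 := (abs_le.1 (abs_risk_sub_empRisk_le L hφ hF hbound hn g.2 z)).1
  linarith [hf.le g.1 g.2]

/-- Jensen's inequality for the margin γ f(h), whose mean under balanced labels is the half-gap. -/
theorem loss_half_condMean_sub_le_risk (hφ : IsLoss φ Lip β) (hfm : Measurable f)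
    (hf : ∀ h, |f h| ≤ β) : φ ((condMean L 1 f - condMean L (-1) f) / 2) ≤ risk φ L f := by
  have hm : Measurable fun z : X × ℤˣ => sgn z.2 * f z.1 :=
    measurable_from_prod_countable_left fun γ => hfm.const_mul (sgn γ)
  have hb (z : X × ℤˣ) : |sgn z.2 * f z.1| ≤ β := by rw [abs_mul, abs_sgn, one_mul]; exact hf _
  have hψ := hφ.isLipschitzFamily
  have hi : Integrable (fun z : X × ℤˣ => φ (sgn z.2 * f z.1)) (trainingLaw L) := by
    refine integrable_of_abs_le (B := Lip * β + |φ 0|) (hφ.continuous.measurable.comp hm)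
      fun z => ?_
    have := (abs_add_le (φ (sgn z.2 * f z.1) - φ 0) (φ 0)).trans
      (add_le_add_left (hψ.abs_le_mul (hf z.1) z.2) _)
    rwa [sub_add_cancel] at this
  have h := hφ.convex.map_integral_le hφ.continuous.continuousOn isClosed_univ
    (.of_forall fun _ => Set.mem_univ _) (integrable_of_abs_le hm hb) hi
  rw [integral_trainingLaw L hm hb] at h
  simpa [sgn, condMean, risk, integral_neg, ← sub_eq_add_neg] using h

theorem IsTrainingSet.map_eq_pi {Ω : Type*} [MeasurableSpace Ω] {P : Measure Ω}
    [IsProbabilityMeasure P] {L : ℤˣ → Measure X} {Z : Fin n → Ω → X × ℤˣ}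
    (hZ : IsTrainingSet P L Z) :
    P.map (fun ω i => Z i ω) = Measure.pi fun _ => trainingLaw L := by
  rw [(iIndepFun_iff_map_fun_eq_pi_map fun i => (hZ.measurable i).aemeasurable).1 hZ.indep]
  simp only [hZ.map_eq]

end Agent

/-! ### Concentration over the network -/

section Network

variable {K : ℕ} {w : Fin K → ℝ} {H : Fin K → Type*} [∀ k, MeasurableSpace (H k)]
  {L : ∀ k, ℤˣ → Measure (H k)} [∀ k γ, IsProbabilityMeasure (L k γ)] {F : ∀ k, Set (H k → ℝ)}
  {N : Fin K → ℕ} {Ω : Type*} [MeasurableSpace Ω] {P : Measure Ω} [IsProbabilityMeasure P]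
  {Z : ∀ k, Fin (N k) → Ω → H k × ℤˣ} {ψ : ℤˣ → ℝ → ℝ} {C β : ℝ}

theorem measureReal_le_sum_ghostDev_le (hw : ∀ k, 0 ≤ w k) (hβ : 0 < β) (hC : 0 < C)
    (hψ : IsLipschitzFamily ψ C β) (hF : ∀ k, IsMeasurableClass (F k))
    (hne : ∀ k, (F k).Nonempty) (hbound : ∀ k, ∀ f ∈ F k, ∀ h, |f h| ≤ β) (hN : ∀ k, 0 < N k)
    (hZ : ∀ k, IsTrainingSet P (L k) (Z k)) {d : ℝ} (hd : netRademacher w L F N < d / 4) :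
    P.real {ω | C * d ≤ ∑ k, w k * ghostDev ψ (L k) (F k) fun n => Z k n ω} ≤
      Real.exp (-(8 * (maxSamples N : ℝ) / (imbalance w N ^ 2 * β ^ 2) *
        (d / 4 - netRademacher w L F N) ^ 2)) := by
  set M : ℝ := (maxSamples N : ℝ) with hM
  have hM0 : 0 ≤ M := Nat.cast_nonneg _
  have hNM k : (N k : ℝ) ≤ M := Nat.cast_le.2 (Finset.le_sup (Finset.mem_univ k))
  have hNpos k : (0 : ℝ) < N k := Nat.cast_pos.2 (hN k)
  let m : Fin K → ℝ := fun k =>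
    ∫ z : Fin (N k) → H k × ℤˣ, ghostDev ψ (L k) (F k) z ∂(Measure.pi fun _ => trainingLaw (L k))
  -- As N k ≤ M, this dominates the true Cβ/√(N k); it is chosen so that the weighted sum is exactly
  -- Cβα/√M.
  let σ : Fin K → ℝ≥0 := fun k => ⟨C * β * √M / N k, by have := hNpos k; positivity⟩
  have hsub k : HasSubgaussianMGF
      (fun ω => ghostDev ψ (L k) (F k) (fun n => Z k n ω) - m k) (σ k ^ 2) P := by
    refine HasSubgaussianMGF.of_map (Y := fun ω n => Z k n ω)
      (X := fun z => ghostDev ψ (L k) (F k) z - m k)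
      (measurable_pi_iff.2 (hZ k).measurable).aemeasurable ?_
    rw [(hZ k).map_eq_pi]
    refine hasSubgaussianMGF_ghostDev (L k) hψ (hF k) (hne k) (hbound k) (hN k) ?_
    have := hNpos k
    change _ ≤ (C * β * √M / N k) ^ 2
    rw [div_pow, mul_pow _ (√M), Real.sq_sqrt hM0, div_le_div_iff₀ this (by positivity)]
    have h2 : 0 ≤ (C * β) ^ 2 * N k := by positivity
    nlinarith [mul_le_mul_of_nonneg_left (hNM k) h2]
  -- The threshold C d minus the mean bound 4Cρ leaves ε = 4C(d/4 - ρ). Then ε²/(2σ²) with σ =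
  -- Cβα/√M gives the constant 8, and C cancels.
  have htail := (hasSubgaussianMGF_weighted_sum hw hsub Finset.univ).measure_ge_le
    (ε := 4 * C * (d / 4 - netRademacher w L F N))
    (mul_nonneg (by positivity) (sub_nonneg.2 hd.le))
  refine (measureReal_mono fun ω hω => ?_).trans (htail.trans_eq ?_)
  · have hm : ∑ k, w k * m k ≤ 4 * C * netRademacher w L F N := by
      rw [netRademacher, Finset.mul_sum]
      refine Finset.sum_le_sum fun k _ => ?_
      rw [mul_left_comm]
      exact mul_le_mul_of_nonneg_left
        (integral_ghostDev_le_rademacher (L k) hψ (hF k) (hne k) (hbound k) (hN k)) (hw k)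
    simp only [Set.mem_ofPred_eq, mul_sub, Finset.sum_sub_distrib] at hω ⊢
    linarith
  · have hσ : ((∑ k, (w k).toNNReal * σ k : ℝ≥0) : ℝ) ^ 2 =
        C ^ 2 * β ^ 2 * imbalance w N ^ 2 / M := by
      have h1 : ((∑ k, (w k).toNNReal * σ k : ℝ≥0) : ℝ) = C * β * √M * ∑ k, w k / N k := by
        push_cast
        rw [Finset.mul_sum]
        refine Finset.sum_congr rfl fun k _ => ?_
        rw [Real.coe_toNNReal _ (hw k)]
        change w k * (C * β * √M / N k) = _
        ring
      have h2 : imbalance w N = M * ∑ k, w k / N k := by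
        rw [imbalance, Finset.mul_sum]
        exact Finset.sum_congr rfl fun k _ => by ring
      rw [h1, h2, mul_pow, mul_pow _ (√M), Real.sq_sqrt hM0]
      -- M = 0 only when there are no agents; division by zero then makes both sides 0.
      rcases hM0.eq_or_lt with h | h
      · simp [← h]
      · field_simp
    congr 1
    rw [NNReal.coe_pow, hσ]
    have := hC.ne'
    rcases eq_or_ne (imbalance w N) 0 with h | h
    · simp [h]
    rcases eq_or_ne M 0 with h' | h'
    · simp [h']
    field_simp
    ring

end Network

end SocialLearning

/-! ### Consistency of training from the two deviation bounds -/

theorem lemma1 {K : ℕ} (A : Matrix (Fin K) (Fin K) ℝ) (hA : IsCombinationMatrix A)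
    (hconn : IsStronglyConnected A) (w : Fin K → ℝ) (hw : IsPerronVector A w)
    {H : Fin K → Type*} [∀ k, MeasurableSpace (H k)]
    (L : ∀ k, ℤˣ → Measure (H k)) [∀ k γ, IsProbabilityMeasure (L k γ)]
    (φ : ℝ → ℝ) (Lip : ℝ≥0) (β : ℝ) (hβ : 0 < β) (hφ : IsLoss φ Lip β)
    (F : ∀ k, Set (H k → ℝ)) (hF : ∀ k, IsMeasurableClass (F k))
    (hbound : ∀ k, ∀ f ∈ F k, ∀ h, |f h| ≤ β)
    (N : Fin K → ℕ) (hN : ∀ k, 0 < N k)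
    {Ω : Type*} [MeasurableSpace Ω] (P : Measure Ω) [IsProbabilityMeasure P]
    (Z : ∀ k, Fin (N k) → Ω → H k × ℤˣ) (hZ : ∀ k, IsTrainingSet P (L k) (Z k))
    (f : Ω → ∀ k, H k → ℝ) (hf : ∀ ω k, IsTrained φ (F k) (fun n => Z k n ω) (f ω k))
    (hR : netTargetRisk w φ L F < φ 0) :
    (∃! d : ℝ, criticalFun φ Lip (netTargetRisk w φ L F) d = 0) ∧
    ∀ d : ℝ, criticalFun φ Lip (netTargetRisk w φ L F) d = 0 →
      0 < d ∧
      (netRademacher w L F N < d / 4 →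
        probConsistent P w L Z f ≥
          1 - 2 * Real.exp (-(8 * (maxSamples N : ℝ) / (imbalance w N ^ 2 * β ^ 2) *
            (d / 4 - netRademacher w L F N) ^ 2))) := by
  have hLip := hφ.lip_pos hβ
  obtain ⟨hex, hpos⟩ := hφ.existsUnique_criticalFun_eq_zero hLip hR
  refine ⟨hex, fun d hd => ⟨hpos d hd, fun hρ => ?_⟩⟩
  have hw0 k : 0 ≤ w k := (hw.pos k).le
  obtain ⟨ω₀⟩ := nonempty_of_isProbabilityMeasure P
  have hne k : (F k).Nonempty := ⟨_, (hf ω₀ k).mem⟩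
  let φ₀ : ℤˣ → ℝ → ℝ := fun γ v => φ (sgn γ * v) - φ 0
  have hB₁ := measureReal_le_sum_ghostDev_le hw0 hβ one_pos isLipschitzFamily_id hF hne hbound hN
    hZ hρ
  have hB₂ := measureReal_le_sum_ghostDev_le hw0 hβ hLip hφ.isLipschitzFamily hF hne hbound hN
    hZ hρ
  set B₁ := {ω | 1 * d ≤ ∑ k, w k * ghostDev (fun _ v => v) (L k) (F k) fun n => Z k n ω}
  set B₂ := {ω | (Lip : ℝ) * d ≤ ∑ k, w k * ghostDev φ₀ (L k) (F k) fun n => Z k n ω}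
  set A := {ω | netCondMean w L 1 (f ω) > netEmpMean w (fun k n => Z k n ω) (f ω) ∧
    netCondMean w L (-1) (f ω) < netEmpMean w (fun k n => Z k n ω) (f ω)}
  -- `A` may fail to be measurable, since `f` depends arbitrarily on ω; covering the whole space
  -- needs only subadditivity, not complements.
  have hcover : Set.univ ⊆ A ∪ (B₁ ∪ B₂) := by
    intro ω _
    by_contra hω
    simp only [Set.mem_union, not_or] at hω
    obtain ⟨hA', h1, h2⟩ := hω
    refine hA' ?_
    have h1 : ∑ k, w k * ghostDev (fun _ v => v) (L k) (F k) (fun n => Z k n ω) < 1 * d :=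
      not_le.1 h1
    have h2 : ∑ k, w k * ghostDev φ₀ (L k) (F k) (fun n => Z k n ω) < Lip * d := not_le.1 h2
    have hmean : |(netCondMean w L 1 (f ω) + netCondMean w L (-1) (f ω)) / 2 -
        netEmpMean w (fun k n => Z k n ω) (f ω)| < d := by
      refine lt_of_le_of_lt ?_ (one_mul d ▸ h1)
      have e : (netCondMean w L 1 (f ω) + netCondMean w L (-1) (f ω)) / 2 -
          netEmpMean w (fun k n => Z k n ω) (f ω) = ∑ k, w k *
            ((condMean (L k) 1 (f ω k) + condMean (L k) (-1) (f ω k)) / 2 -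
              empMean (fun n => Z k n ω) (f ω k)) := by
        simp only [netCondMean, netEmpMean, ← Finset.sum_add_distrib, Finset.sum_div,
          ← Finset.sum_sub_distrib]
        exact Finset.sum_congr rfl fun k _ => by ring
      rw [e]
      refine (Finset.abs_sum_le_sum_abs _ _).trans (Finset.sum_le_sum fun k _ => ?_)
      rw [abs_mul, abs_of_nonneg (hw0 k)]
      exact mul_le_mul_of_nonneg_left (abs_condMean_sub_empMean_le (L k) (hF k) (hbound k) (hN k)
        (hf ω k).mem _) (hw0 k)
    have hrisk : ∑ k, w k * risk φ (L k) (f ω k) < φ d := by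
      have hle : ∑ k, w k * risk φ (L k) (f ω k) ≤ netTargetRisk w φ L F +
          2 * ∑ k, w k * ghostDev φ₀ (L k) (F k) fun n => Z k n ω := by
        rw [netTargetRisk, Finset.mul_sum, ← Finset.sum_add_distrib]
        refine Finset.sum_le_sum fun k _ => ?_
        have := mul_le_mul_of_nonneg_left
          (risk_le_targetRisk_add (L k) hφ (hF k) (hbound k) (hN k) (hf ω k)) (hw0 k)
        linarith
      -- The critical equation: the allowed excess risk 2 Lip d raises Rᵒ exactly to φ d.
      have hd' : φ d - netTargetRisk w φ L F = d * (2 * Lip) := by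
        rw [criticalFun, sub_eq_zero] at hd
        exact ((eq_div_iff (by positivity)).1 hd).symm
      linarith
    have hjensen : φ ((netCondMean w L 1 (f ω) - netCondMean w L (-1) (f ω)) / 2) ≤
        ∑ k, w k * risk φ (L k) (f ω k) := by
      have h := hφ.convex.map_sum_le (t := Finset.univ) (w := w)
        (p := fun k => (condMean (L k) 1 (f ω k) - condMean (L k) (-1) (f ω k)) / 2)
        (fun k _ => hw0 k) hw.sum_eq_one fun _ _ => Set.mem_univ _
      have e : (netCondMean w L 1 (f ω) - netCondMean w L (-1) (f ω)) / 2 = ∑ k, w k •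
          ((condMean (L k) 1 (f ω k) - condMean (L k) (-1) (f ω k)) / 2) := by
        simp only [netCondMean, ← Finset.sum_sub_distrib, Finset.sum_div, smul_eq_mul]
        exact Finset.sum_congr rfl fun k _ => by ring
      rw [e]
      exact h.trans (Finset.sum_le_sum fun k _ => mul_le_mul_of_nonneg_left
        (loss_half_condMean_sub_le_risk (L k) hφ ((hF k).measurable _ (hf ω k).mem)
          (hbound k _ (hf ω k).mem)) (hw0 k))
    have hgap : d < (netCondMean w L 1 (f ω) - netCondMean w L (-1) (f ω)) / 2 :=
      hφ.antitone.reflect_lt (hjensen.trans_lt hrisk)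
    obtain ⟨h3, h4⟩ := abs_lt.1 hmean
    exact ⟨by linarith, by linarith⟩
  have hone : 1 ≤ P.real A + (P.real B₁ + P.real B₂) := by
    rw [← probReal_univ (μ := P)]
    exact (measureReal_mono hcover).trans ((measureReal_union_le _ _).trans
      (by gcongr; exact measureReal_union_le _ _))
  change P.real A ≥ _
  linarith
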